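/- For $0<\theta<\pi/2$ let $T_\theta\subset\mathbb{C}$ be the open right triangle with vertices $0,\ \cos\theta,\ e^{i\theta}$. Let $0<\alpha,\beta<\pi/2$ with $\alpha\neq\beta$, put $P=T_\alpha$, $Q=T_\beta$, and let $f\colon P\to Q$ be the conformal bijection that extends to a homeomorphism $\overline P\to\overline Q$ with $0\mapsto 0$, $\cos\alpha\mapsto\cos\beta$, $e^{i\alpha}\mapsto e^{i\beta}$. Let $\mathcal F$ be the set of all pairs $(U,g)$, with $U\subset\mathbb{C}$ a domain and $g\colon U\to\mathbb{C}$ holomorphic, that are reached from $(P,f)$ by a finite chain of direct analytic continuations (two pairs $(U_1,g_1),(U_2,g_2)$ being direct analytic continuations of each other if $U_1\cap U_2\neq\emptyset$ and $g_1=g_2$ on $U_1\cap U_2$). Let $[P|Q]\subset\mathbb{C}^2$ be the Riemann surface consisting of all points $(x,g(x))$ with $(U,g)\in\mathcal F$, $x\in U$, together with the algebraic branch points of $\mathcal F$, i.e. the points $(x_0,h(0))$ for which there are an integer $n\ge 1$ and a function $h$ holomorphic on a disk $|t|<r$ such that for each $t$ with $0<|t|<r$ some $(U,g)\in\mathcal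 F$ satisfies $x_0+t^n\in U$ and $g(x_0+s^n)=h(s)$ for all $s$ near $t$. If $[P|Q]$ is discrete, that is, if for every $x\in\mathbb{C}$ the section $\{y\in\mathbb{C}:(x,y)\in[P|Q]\}$ is a discrete set (each of its points is isolated in it), then $\alpha$ and $\beta$ are rational multiples of $\pi$. -/

import Mathlib

open Set Filter Topology

/-- A function element: a holomorphic function on a domain (a nonempty connected open set) of `ℂ`.
The values of `toFun` off `domain` are irrelevant. -/
structure FunctionElement where
  domain : Set ℂ
  toFun : ℂ → ℂ
  isOpen_domain : IsOpen domain
  isConnected_domain : IsConnected domain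
  differentiableOn : DifferentiableOn ℂ toFun domain

namespace FunctionElement

/-- Two function elements are direct analytic continuations of each other if their domains meet
and the functions agree on the whole intersection. -/
def DirectContinuation (F G : FunctionElement) : Prop :=
  (F.domain ∩ G.domain).Nonempty ∧ EqOn F.toFun G.toFun (F.domain ∩ G.domain)

/-- The complete global analytic function determined by `F`: all function elements that are
reached from `F` by a finite chain of direct analytic continuations. -/
def globalAnalyticFunction (F : FunctionElement) : Set FunctionElement :=
  {G | Relation.ReflTransGen DirectContinuation F G}

/-- The graph `{(x, f x) : x ∈ U}` of a function element `(U, f)`. -/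
def graph (F : FunctionElement) : Set (ℂ × ℂ) :=
  {p | p.1 ∈ F.domain ∧ p.2 = F.toFun p.1}

/-- `p = (x₀, y₀)` is an algebraic point of the global analytic function determined by `F`:
it is the centre of a branch `t ↦ (x₀ + t ^ n, h t)`, with `h` holomorphic near `0` and `h 0 = y₀`,
which away from `t = 0` is made of function elements of that global analytic function.
(If `h t - y₀` vanishes to order `m` at `0`, this is a branch that behaves like
`(y - y₀) ^ n = c * (x - x₀) ^ m`.) -/
def IsAlgebraicPoint (F : FunctionElement) (p : ℂ × ℂ) : Prop :=
  ∃ n : ℕ, 0 < n ∧ ∃ r : ℝ, 0 < r ∧ ∃ h : ℂ → ℂ,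
    DifferentiableOn ℂ h (Metric.ball 0 r) ∧ h 0 = p.2 ∧
    ∀ t ∈ Metric.ball (0 : ℂ) r, t ≠ 0 →
      ∃ G ∈ F.globalAnalyticFunction, p.1 + t ^ n ∈ G.domain ∧
        ∀ᶠ s in 𝓝 t, G.toFun (p.1 + s ^ n) = h s

/-- The (complete, immersed) Riemann surface in `X × Y = ℂ × ℂ` determined by `F`: the union of
the graphs of the function elements of the global analytic function determined by `F`,
together with its algebraic points. -/
def riemannSurface (F : FunctionElement) : Set (ℂ × ℂ) :=
  (⋃ G ∈ F.globalAnalyticFunction, G.graph) ∪ {p | F.IsAlgebraicPoint p}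

end FunctionElement

/-- The section of a surface `S ⊆ X × Y` at `x`. -/
def surfaceSection (S : Set (ℂ × ℂ)) (x : ℂ) : Set ℂ :=
  {y | (x, y) ∈ S}

/-- A surface is discrete if each of its sections is a discrete set: every point of the section
is isolated in it. -/
def IsDiscreteSurface (S : Set (ℂ × ℂ)) : Prop :=
  ∀ x : ℂ, IsDiscrete (surfaceSection S x)

/-- The open triangle with vertices `v 0`, `v 1`, `v 2`. -/
def openTriangle (v : Fin 3 → ℂ) : Set ℂ :=
  interior (convexHull ℝ (range v))

/-- The function element `F` is `(P, f)`, where `f` is the conformal map from the open triangle `P`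
with vertices `x i` onto the open triangle `Q` with vertices `y i` which extends to a homeomorphism
of the closed triangles that takes each `x i` to `y i`. (A continuous bijection of the closed
triangles is a homeomorphism, as these are compact.) Thus `F.graph` is the triangular graph `P|Q`
and `F.riemannSurface` is the surface `[P|Q]`. -/
structure IsTriangleMap (x y : Fin 3 → ℂ) (F : FunctionElement) : Prop where
  domain_eq : F.domain = openTriangle x
  bijOn : BijOn F.toFun (openTriangle x) (openTriangle y)
  exists_extension : ∃ e : ℂ → ℂ, EqOn e F.toFun (openTriangle x) ∧
    ContinuousOn e (closure (openTriangle x)) ∧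
    BijOn e (closure (openTriangle x)) (closure (openTriangle y)) ∧
    ∀ i, e (x i) = y i

/-- The vertices `0`, `cos θ`, `exp (i θ)` of the standard right triangle with angle `θ` at `0`
and the right angle at `cos θ`. -/
noncomputable def rightTriangleVertices (θ : ℝ) : Fin 3 → ℂ :=
  ![0, (Real.cos θ : ℂ), Complex.exp ((θ : ℂ) * Complex.I)]

/-! By Schwarz reflection the surface is invariant under the pair of reflections in corresponding
sides of the two triangles, for each of the three sides. Two sides meeting at `0` give rotations
with multipliers `u = exp (2iα)` and `v = exp (2iβ)`; the two sides meeting at the right angle give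
half turns about `cos α` and `cos β`. The half turn, followed by its conjugate under the `k`-th
power of the rotation, is the translation of `ℂ × ℂ` by `(2 cos α (u ^ k - 1), 2 cos β (v ^ k -
1))`.

If one of the angles is not a rational multiple of `π`, no `k > 0` gives `u ^ k = v ^ k = 1`.
Compactness of the torus then yields translations `(a n, b n)`, all nonzero, tending to `0`. For `x`
in the triangle, `f (x - a n) + b n` lies in the section over `x` and tends to `f x`, so
discreteness forces equality for large `n`. The threshold depends on `x`, but two holomorphic
functions that differ somewhere on a domain agree only on a countable set, so for infinitely many
`n` the equality is an identity. Hence `f'` repeats its value at points accumulating at an interior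
point and is constant. An affine `f` makes the triangles similar, so `α = β`.

The reflection principle is `IsTriangleMap.reflect_mem_globalAnalyticFunction`, the translations
come from `translate_mem_of_reflect_mem`, and rigidity is
`exists_affine_of_eventually_translate_eq`. Only graph points of the surface enter; its branch
points play no role. -/

open ComplexConjugate

/-! ### Removability of a line, and reflections in lines -/

/-- **Painlevé's theorem** for the real line: a continuous function on a disc that is holomorphic
off the real line is holomorphic. -/
theorem differentiableOn_ball_of_off_real {f : ℂ → ℂ} {c : ℂ} {r : ℝ}
    (hc : ContinuousOn f (Metric.ball c r))
    (hd : DifferentiableOn ℂ f (Metric.ball c r ∩ {z | z.im ≠ 0})) :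
    DifferentiableOn ℂ f (Metric.ball c r) := by
  refine (Complex.IsConservativeOn.isExactOn_ball hc ?_).differentiableOn Metric.isOpen_ball
  intro z w hzw
  rw [← add_eq_zero_iff_eq_neg, Complex.wedgeIntegral_add_wedgeIntegral_eq]
  -- Cauchy's theorem needs holomorphy only inside the rectangle, so an edge may lie on the real
  -- axis.
  have key : ∀ y₁ y₂ : ℝ, uIcc y₁ y₂ ⊆ uIcc z.im w.im → (0 : ℝ) ∉ Ioo (min y₁ y₂) (max y₁ y₂) →
      (∫ x : ℝ in z.re..w.re, f (x + y₁ * Complex.I)) -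
      (∫ x : ℝ in z.re..w.re, f (x + y₂ * Complex.I)) +
      Complex.I • (∫ y : ℝ in y₁..y₂, f (w.re + y * Complex.I)) -
      Complex.I • (∫ y : ℝ in y₁..y₂, f (z.re + y * Complex.I)) = 0 := by
    intro y₁ y₂ hy h0
    have hsub : uIcc z.re w.re ×ℂ uIcc y₁ y₂ ⊆ Metric.ball c r :=
      (inter_subset_inter Subset.rfl (preimage_mono hy)).trans hzw
    have := Complex.integral_boundary_rect_eq_zero_of_continuousOn_of_differentiableOn f
      (z.re + y₁ * Complex.I) (w.re + y₂ * Complex.I)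
    simp only [Complex.add_re, Complex.ofReal_re, Complex.mul_re, Complex.I_re, mul_zero,
      Complex.ofReal_im, Complex.I_im, sub_self, add_zero, Complex.add_im, Complex.mul_im,
      mul_one, zero_add] at this
    refine this (hc.mono hsub) (hd.mono ?_)
    rintro t ⟨ht1, ht2⟩
    refine ⟨hsub ⟨Ioo_subset_Icc_self ht1, Ioo_subset_Icc_self ht2⟩, ?_⟩
    intro h
    exact h0 (h ▸ ht2)
  -- A rectangle meeting the axis is cut at height `0`; the integrals along the cut cancel.
  by_cases h0 : (0 : ℝ) ∈ uIcc z.im w.im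
  · have h1 := key z.im 0 (uIcc_subset_uIcc_left h0) (by grind)
    have h2 := key 0 w.im (uIcc_subset_uIcc_right h0) (by grind)
    have hint : ∀ a : ℝ, a ∈ uIcc z.re w.re → ∀ y₁ ∈ uIcc z.im w.im, ∀ y₂ ∈ uIcc z.im w.im,
        IntervalIntegrable (fun y : ℝ => f (a + y * Complex.I)) MeasureTheory.volume y₁ y₂ := by
      intro a ha y₁ hy₁ y₂ hy₂
      refine (hc.comp (f := fun y : ℝ => (a + y * Complex.I : ℂ)) (by fun_prop)
        ?_).intervalIntegrable
      intro y hy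
      refine hzw ⟨by simpa using ha, ?_⟩
      have := uIcc_subset_uIcc hy₁ hy₂ hy
      simpa using this
    have hl : (z.im : ℝ) ∈ uIcc z.im w.im := left_mem_uIcc
    have hr : (w.im : ℝ) ∈ uIcc z.im w.im := right_mem_uIcc
    rw [← intervalIntegral.integral_add_adjacent_intervals
        (hint _ right_mem_uIcc _ hl _ h0) (hint _ right_mem_uIcc _ h0 _ hr),
      ← intervalIntegral.integral_add_adjacent_intervals
        (hint _ left_mem_uIcc _ hl _ h0) (hint _ left_mem_uIcc _ h0 _ hr), smul_add, smul_add]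
    linear_combination h1 + h2
  · exact key z.im w.im Subset.rfl (fun h => h0 (Ioo_subset_Icc_self h))

/-- The signed distance of `z` to the line through `q` with direction `w⁻¹`. -/
def lineForm (q w z : ℂ) : ℝ := (w * (z - q)).im

/-- The reflection in the line `lineForm q w z = 0`, where `w` is a unit. -/
noncomputable def lineReflection (q w z : ℂ) : ℂ := q + conj w * conj (w * (z - q))

theorem continuous_lineForm (q w : ℂ) : Continuous (lineForm q w) := by
  unfold lineForm; fun_prop

theorem continuous_lineReflection (q w : ℂ) : Continuous (lineReflection q w) := by
  unfold lineReflection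
  exact continuous_const.add (continuous_const.mul (Complex.continuous_conj.comp (by fun_prop)))

theorem mul_conj_of_norm_eq_one {w : ℂ} (hw : ‖w‖ = 1) : w * conj w = 1 := by
  rw [Complex.mul_conj, Complex.normSq_eq_norm_sq, hw]; simp

theorem lineReflection_involutive {q w : ℂ} (hw : ‖w‖ = 1) :
    Function.Involutive (lineReflection q w) := by
  intro z
  have h := mul_conj_of_norm_eq_one hw
  simp only [lineReflection, map_mul, map_sub, map_add, Complex.conj_conj]
  linear_combination (z - q) * (1 + w * conj w) * h

theorem lineForm_lineReflection {q w : ℂ} (hw : ‖w‖ = 1) (z : ℂ) :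
    lineForm q w (lineReflection q w z) = -lineForm q w z := by
  have h := mul_conj_of_norm_eq_one hw
  have : w * (lineReflection q w z - q) = conj (w * (z - q)) := by
    simp only [lineReflection]
    linear_combination conj (w * (z - q)) * h
  rw [lineForm, this, Complex.conj_im, lineForm]

theorem lineReflection_eq_self {q w z : ℂ} (hw : ‖w‖ = 1) (hz : lineForm q w z = 0) :
    lineReflection q w z = z := by
  have h := mul_conj_of_norm_eq_one hw
  rw [lineReflection, Complex.conj_eq_iff_im.2 hz]
  linear_combination (z - q) * h

/-- A continuous function on a disc that is holomorphic off a line is holomorphic. -/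
theorem differentiableOn_ball_of_off_line {f : ℂ → ℂ} {q w c : ℂ} {r : ℝ} (hw : ‖w‖ = 1)
    (hc : ContinuousOn f (Metric.ball c r))
    (hd : DifferentiableOn ℂ f (Metric.ball c r ∩ {z | lineForm q w z ≠ 0})) :
    DifferentiableOn ℂ f (Metric.ball c r) := by
  have h := mul_conj_of_norm_eq_one hw
  let φ : ℂ → ℂ := fun t => q + conj w * t
  let ψ : ℂ → ℂ := fun z => w * (z - q)
  have hφd : Differentiable ℂ φ := by fun_prop
  have hψd : Differentiable ℂ ψ := by fun_prop
  have hφψ : ∀ z, φ (ψ z) = z := fun z => by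
    simp only [φ, ψ]; linear_combination (z - q) * h
  have hψφ : ∀ z, ψ (φ z) = z := fun z => by
    simp only [φ, ψ]; linear_combination z * h
  have hdist : ∀ z z', dist (ψ z) (ψ z') = dist z z' := fun z z' => by
    rw [dist_eq_norm, dist_eq_norm, show ψ z - ψ z' = w * (z - z') by simp only [ψ]; ring,
      norm_mul, hw, one_mul]
  have hφm : MapsTo φ (Metric.ball (ψ c) r) (Metric.ball c r) := fun t ht => by
    rw [Metric.mem_ball, ← hdist, hψφ]; exact ht
  have hψm : MapsTo ψ (Metric.ball c r) (Metric.ball (ψ c) r) := fun t ht => by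
    rw [Metric.mem_ball, hdist]; exact ht
  have : DifferentiableOn ℂ (f ∘ φ) (Metric.ball (ψ c) r) := by
    refine differentiableOn_ball_of_off_real (hc.comp hφd.continuous.continuousOn hφm) ?_
    refine hd.comp hφd.differentiableOn ?_
    rintro t ⟨ht, ht0⟩
    refine ⟨hφm ht, ?_⟩
    change (ψ (φ t)).im ≠ 0
    rwa [hψφ]
  refine (this.comp hψd.differentiableOn hψm).congr ?_
  intro z _
  simp [hφψ]

/-- Conjugating a holomorphic function by reflections gives a holomorphic function. -/
theorem DifferentiableAt.lineReflection_comp {f : ℂ → ℂ} {q w q' w' z : ℂ}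
    (hf : DifferentiableAt ℂ f (lineReflection q w z)) :
    DifferentiableAt ℂ (fun z => lineReflection q' w' (f (lineReflection q w z))) z := by
  -- Moving all conjugations to the two ends leaves a holomorphic function between them, to which
  -- `conj_conj` applies.
  have h1 : DifferentiableAt ℂ (fun t => w' * (f (q + conj w * (conj w * (t - conj q))) - q'))
      (conj z) := by
    refine ((DifferentiableAt.comp (conj z) (g := f) ?_ (by fun_prop)).sub_const _).const_mul _
    simpa [lineReflection] using hf
  have h2 := h1.conj_conj
  rw [Complex.conj_conj] at h2
  refine ((h2.const_mul (conj w')).const_add q').congr_of_eventuallyEq (Eventually.of_forall ?_)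
  intro t
  simp [lineReflection]

/-! ### Countable form of the identity theorem -/

/-- Two holomorphic functions on a domain agree everywhere or at most on a countable set. -/
theorem eqOn_or_countable_setOf_eq {f g : ℂ → ℂ} {U : Set ℂ} (hU : IsOpen U)
    (hU' : IsPreconnected U) (hf : DifferentiableOn ℂ f U) (hg : DifferentiableOn ℂ g U) :
    EqOn f g U ∨ {x | x ∈ U ∧ f x = g x}.Countable := by
  by_cases h : ∃ z ∈ U, ∃ᶠ x in 𝓝[≠] z, f x = g x
  · obtain ⟨z, hz, h⟩ := h
    exact Or.inl ((hf.analyticOnNhd hU).eqOn_of_preconnected_of_frequently_eq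
      (hg.analyticOnNhd hU) hU' hz h)
  · right
    push Not at h
    refine (HereditarilyLindelofSpace.isLindelof _).countable_of_isDiscrete ?_
    rw [isDiscrete_iff_nhdsWithin]
    rintro x hx
    refine le_antisymm ?_ (pure_le_nhdsWithin hx)
    rw [le_pure_iff, mem_nhdsWithin_iff_eventually]
    have := h x hx.1
    rw [eventually_nhdsWithin_iff] at this
    filter_upwards [this] with y hy hy'
    by_contra hne
    exact hy hne hy'.2

/-! ### The standard right triangle as an intersection of half-planes -/

/-- A base point of the side line opposite to vertex `i` of the standard right triangle. -/
noncomputable def sideBase (θ : ℝ) : Fin 3 → ℂ := ![(Real.cos θ : ℂ), 0, 0]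

/-- The inverse direction of the side line opposite to vertex `i`. -/
noncomputable def sideDir (θ : ℝ) : Fin 3 → ℂ :=
  ![-Complex.I, -Complex.exp (-(θ : ℂ) * Complex.I), 1]

/-- The signed distance to the side line opposite to vertex `i`, positive in the triangle. -/
noncomputable def sideForm (θ : ℝ) (i : Fin 3) (z : ℂ) : ℝ :=
  lineForm (sideBase θ i) (sideDir θ i) z

/-- The reflection in the side opposite to vertex `i`. -/
noncomputable def sideReflection (θ : ℝ) (i : Fin 3) (z : ℂ) : ℂ :=
  lineReflection (sideBase θ i) (sideDir θ i) z

theorem norm_sideDir (θ : ℝ) (i : Fin 3) : ‖sideDir θ i‖ = 1 := by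
  fin_cases i
  · simp [sideDir]
  · have := Complex.norm_exp_ofReal_mul_I (-θ)
    simpa [sideDir] using this
  · simp [sideDir]

theorem sideForm_zero (θ : ℝ) (z : ℂ) : sideForm θ 0 z = Real.cos θ - z.re := by
  simp [sideForm, lineForm, sideBase, sideDir, -Complex.ofReal_cos]

theorem sideForm_one (θ : ℝ) (z : ℂ) :
    sideForm θ 1 z = Real.sin θ * z.re - Real.cos θ * z.im := by
  have : Complex.exp (-(θ : ℂ) * Complex.I) = (Real.cos θ : ℂ) - Real.sin θ * Complex.I := by
    rw [Complex.exp_mul_I, Complex.cos_neg, Complex.sin_neg]; push_cast; ring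
  simp only [sideForm, lineForm, sideBase, sideDir, Matrix.cons_val_one, Matrix.cons_val_zero, this]
  simp [-Complex.ofReal_sin, -Complex.ofReal_cos]
  ring

theorem sideForm_two (θ : ℝ) (z : ℂ) : sideForm θ 2 z = z.im := by
  simp [sideForm, lineForm, sideBase, sideDir]

theorem continuous_sideForm (θ : ℝ) (i : Fin 3) : Continuous (sideForm θ i) :=
  continuous_lineForm _ _

theorem continuous_sideReflection (θ : ℝ) (i : Fin 3) : Continuous (sideReflection θ i) :=
  continuous_lineReflection _ _

theorem sideReflection_involutive (θ : ℝ) (i : Fin 3) : Function.Involutive (sideReflection θ i) :=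
  lineReflection_involutive (norm_sideDir θ i)

theorem sideForm_sideReflection (θ : ℝ) (i : Fin 3) (z : ℂ) :
    sideForm θ i (sideReflection θ i z) = -sideForm θ i z :=
  lineForm_lineReflection (norm_sideDir θ i) z

theorem sideReflection_eq_self {θ : ℝ} {i : Fin 3} {z : ℂ} (hz : sideForm θ i z = 0) :
    sideReflection θ i z = z :=
  lineReflection_eq_self (norm_sideDir θ i) hz

theorem sideForm_combo (θ : ℝ) (i : Fin 3) (x y : ℂ) {a b : ℝ} (hab : a + b = 1) :
    sideForm θ i (a • x + b • y) = a * sideForm θ i x + b * sideForm θ i y := by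
  obtain rfl : b = 1 - a := by linarith
  fin_cases i
  · simp [sideForm_zero]; ring
  · simp [sideForm_one]; ring
  · simp [sideForm_two]

theorem vertex_eq (θ : ℝ) : rightTriangleVertices θ 2 = Real.cos θ + Real.sin θ * Complex.I := by
  simp [rightTriangleVertices, Complex.exp_mul_I]

section Acute

variable {θ : ℝ} (hθ : 0 < θ ∧ θ < Real.pi / 2)
include hθ

theorem cos_pos_of_acute : 0 < Real.cos θ :=
  Real.cos_pos_of_mem_Ioo ⟨by linarith [hθ.1, Real.pi_pos], hθ.2⟩

theorem sin_pos_of_acute : 0 < Real.sin θ :=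
  Real.sin_pos_of_pos_of_lt_pi hθ.1 (by linarith [hθ.2, Real.pi_pos])

theorem sideForm_vertex_self (i : Fin 3) : 0 < sideForm θ i (rightTriangleVertices θ i) := by
  have hc := cos_pos_of_acute hθ
  have hs := sin_pos_of_acute hθ
  fin_cases i
  · simpa [sideForm_zero, rightTriangleVertices] using hc
  · simpa [sideForm_one, rightTriangleVertices, -Complex.ofReal_cos] using mul_pos hs hc
  · simpa [sideForm_two, vertex_eq, -Complex.ofReal_cos, -Complex.ofReal_sin] using hs

omit hθ in
theorem sideForm_vertex_ne {i j : Fin 3} (hij : i ≠ j) :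
    sideForm θ i (rightTriangleVertices θ j) = 0 := by
  fin_cases i <;> fin_cases j <;> first
    | exact absurd rfl hij
    | (simp [sideForm_zero, sideForm_one, sideForm_two, vertex_eq, -Complex.ofReal_cos,
        -Complex.ofReal_sin]; try simp [rightTriangleVertices, -Complex.ofReal_cos]) <;> try ring

theorem sideForm_vertex_nonneg (i j : Fin 3) : 0 ≤ sideForm θ i (rightTriangleVertices θ j) := by
  rcases eq_or_ne i j with rfl | h
  · exact (sideForm_vertex_self hθ i).le
  · exact (sideForm_vertex_ne h).ge

omit hθ in
theorem convex_closedTriangle : Convex ℝ {z | ∀ i, 0 ≤ sideForm θ i z} := by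
  intro x hx y hy a b ha hb hab i
  rw [sideForm_combo θ i x y hab]
  have := hx i
  have := hy i
  positivity

omit hθ in
theorem isClosed_closedTriangle : IsClosed {z | ∀ i, 0 ≤ sideForm θ i z} := by
  rw [ofPred_forall]
  exact isClosed_iInter fun i => isClosed_le continuous_const (continuous_sideForm θ i)

theorem convexHull_rightTriangleVertices :
    convexHull ℝ (range (rightTriangleVertices θ)) = {z | ∀ i, 0 ≤ sideForm θ i z} := by
  have hc := cos_pos_of_acute hθ
  have hs := sin_pos_of_acute hθ
  apply Subset.antisymm
  · refine convexHull_min ?_ convex_closedTriangle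
    rintro _ ⟨j, rfl⟩ i
    exact sideForm_vertex_nonneg hθ i j
  · intro z hz
    have h0 := hz 0
    have h1 := hz 1
    have h2 := hz 2
    rw [sideForm_zero] at h0
    rw [sideForm_one] at h1
    rw [sideForm_two] at h2
    -- The barycentric coordinate of `z` at vertex `i` is `sideForm θ i z` divided by its value at
    -- that vertex; `m` is the one at the right angle.
    obtain ⟨m, hm0, hm⟩ : ∃ m : ℝ, 0 ≤ m ∧
        m * (Real.sin θ * Real.cos θ) = Real.sin θ * z.re - Real.cos θ * z.im :=
      ⟨(Real.sin θ * z.re - Real.cos θ * z.im) / (Real.sin θ * Real.cos θ), by positivity,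
        by field_simp⟩
    have hmem : ∀ i, rightTriangleVertices θ i ∈ convexHull ℝ (range (rightTriangleVertices θ)) :=
      fun i => subset_convexHull ℝ _ (mem_range_self i)
    have := (convex_convexHull ℝ (range (rightTriangleVertices θ))).sum_mem
      (t := Finset.univ) (w := ![1 - z.re / Real.cos θ, m, z.im / Real.sin θ])
      (z := rightTriangleVertices θ) ?_ ?_ (fun i _ => hmem i)
    · convert this using 1
      rw [Fin.sum_univ_three, vertex_eq]
      apply Complex.ext
      · simp [rightTriangleVertices, -Complex.ofReal_cos, -Complex.ofReal_sin]
        field_simp; linear_combination -hm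
      · simp [rightTriangleVertices, -Complex.ofReal_cos, -Complex.ofReal_sin]
        field_simp
    · intro i _
      fin_cases i
      · simp only [Fin.zero_eta, Matrix.cons_val_zero, sub_nonneg]
        rw [div_le_one hc]; linarith
      · simp only [Fin.mk_one, Matrix.cons_val_one, Matrix.cons_val_zero]
        exact hm0
      · simp only [Fin.reduceFinMk, Matrix.cons_val]
        positivity
    · rw [Fin.sum_univ_three]
      simp only [Matrix.cons_val_zero, Matrix.cons_val_one, Matrix.cons_val]
      field_simp; linear_combination hm

-- Openness lets `interior` commute with preimages of half-lines, which turns the closed half-planes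
-- into open ones.
omit hθ in
theorem isOpenMap_sideForm (i : Fin 3) : IsOpenMap (sideForm θ i) := by
  have hw : sideDir θ i ≠ 0 := fun h => by simpa [h] using norm_sideDir θ i
  exact Complex.isOpenMap_im.comp
    ((Homeomorph.mulLeft₀ _ hw).isOpenMap.comp (Homeomorph.subRight (sideBase θ i)).isOpenMap)

theorem openTriangle_rightTriangleVertices :
    openTriangle (rightTriangleVertices θ) = {z | ∀ i, 0 < sideForm θ i z} := by
  rw [openTriangle, convexHull_rightTriangleVertices hθ, ofPred_forall, ofPred_forall,
    interior_iInter_of_finite]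
  refine iInter_congr fun i => ?_
  have := (isOpenMap_sideForm (θ := θ) i).preimage_interior_eq_interior_preimage
    (continuous_sideForm θ i) (Ici 0)
  rw [interior_Ici] at this
  exact this.symm

theorem exists_mem_side (i : Fin 3) :
    ∃ p, sideForm θ i p = 0 ∧ ∀ j, j ≠ i → 0 < sideForm θ j p := by
  have key : ∀ j k : Fin 3, (∀ l, l ≠ i → l = j ∨ l = k) → i ≠ j → i ≠ k →
      ∃ p, sideForm θ i p = 0 ∧ ∀ j, j ≠ i → 0 < sideForm θ j p := by
    intro j k h hj hk
    refine ⟨(1 / 2 : ℝ) • rightTriangleVertices θ j + (1 / 2 : ℝ) • rightTriangleVertices θ k,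
      ?_, ?_⟩
    · rw [sideForm_combo _ _ _ _ (by norm_num), sideForm_vertex_ne hj, sideForm_vertex_ne hk]
      simp
    · intro l hl
      rw [sideForm_combo _ _ _ _ (by norm_num)]
      have h1 := sideForm_vertex_nonneg hθ l j
      have h2 := sideForm_vertex_nonneg hθ l k
      rcases h l hl with rfl | rfl
      · have := sideForm_vertex_self hθ l
        positivity
      · have := sideForm_vertex_self hθ l
        positivity
  fin_cases i
  · exact key 1 2 (by decide) (by decide) (by decide)
  · exact key 0 2 (by decide) (by decide) (by decide)
  · exact key 0 1 (by decide) (by decide) (by decide)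

-- The segment from `z` to `p` stays in the face after leaving `z`. With `S = {i}ᶜ` the face is an
-- open side, whose closure thus contains its end vertices.
omit hθ in
theorem mem_closure_of_forall_sideForm {S : Set (Fin 3)} {p z : ℂ}
    (hp : ∀ i ∈ S, 0 < sideForm θ i p) (hp' : ∀ i ∉ S, sideForm θ i p = 0)
    (hz : ∀ i, 0 ≤ sideForm θ i z) (hz' : ∀ i ∉ S, sideForm θ i z = 0) :
    z ∈ closure {x | (∀ i ∈ S, 0 < sideForm θ i x) ∧ ∀ i ∉ S, sideForm θ i x = 0} := by
  have : ∀ t ∈ Ioo (0 : ℝ) 1, t • p + (1 - t) • z ∈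
      {x | (∀ i ∈ S, 0 < sideForm θ i x) ∧ ∀ i ∉ S, sideForm θ i x = 0} := by
    intro t ht
    refine ⟨fun i hi => ?_, fun i hi => ?_⟩
    · rw [sideForm_combo _ _ _ _ (by ring)]
      have h1 := hp i hi
      have h2 := hz i
      have h3 := ht.1
      have h4 : 0 < 1 - t := by linarith [ht.2]
      positivity
    · rw [sideForm_combo _ _ _ _ (by ring), hp' i hi, hz' i hi]; simp
  refine closure_mono (s := (fun t : ℝ => t • p + (1 - t) • z) '' Ioo 0 1)
    (by rintro _ ⟨t, ht, rfl⟩; exact this t ht) ?_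
  have hcont : Continuous (fun t : ℝ => t • p + (1 - t) • z) := by fun_prop
  have h0 : (0 : ℝ) ∈ closure (Ioo (0 : ℝ) 1) := by
    rw [closure_Ioo (by norm_num)]; simp
  have := image_closure_subset_closure_image hcont (mem_image_of_mem _ h0)
  simpa using this

theorem exists_forall_sideForm_pos : ∃ p, ∀ i, 0 < sideForm θ i p := by
  obtain ⟨p, hp, hp'⟩ := exists_mem_side hθ 0
  refine ⟨(1 / 2 : ℝ) • p + (1 / 2 : ℝ) • rightTriangleVertices θ 0, fun i => ?_⟩
  rw [sideForm_combo _ _ _ _ (by norm_num)]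
  rcases eq_or_ne i 0 with rfl | h
  · rw [hp]
    have := sideForm_vertex_self hθ 0
    positivity
  · rw [sideForm_vertex_ne h]
    have := hp' i h
    positivity

theorem closure_openTriangle_rightTriangleVertices :
    closure (openTriangle (rightTriangleVertices θ)) = {z | ∀ i, 0 ≤ sideForm θ i z} := by
  obtain ⟨p, hp⟩ := exists_forall_sideForm_pos hθ
  rw [openTriangle, (convex_convexHull ℝ _).closure_interior_eq_closure_of_nonempty_interior,
    convexHull_rightTriangleVertices hθ, isClosed_closedTriangle.closure_eq]
  refine ⟨p, ?_⟩
  have := openTriangle_rightTriangleVertices hθ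
  rw [openTriangle] at this
  rw [this]
  exact hp

theorem eq_vertex_of_sideForm_eq_zero {z : ℂ} (j : Fin 3)
    (hz : ∀ i, i ≠ j → sideForm θ i z = 0) : z = rightTriangleVertices θ j := by
  have hc := cos_pos_of_acute hθ
  have hs := sin_pos_of_acute hθ
  have h0 := hz 0
  have h1 := hz 1
  have h2 := hz 2
  rw [sideForm_zero] at h0
  rw [sideForm_one] at h1
  rw [sideForm_two] at h2
  fin_cases j
  · have h2 := h2 (by decide)
    have h1 := h1 (by decide)
    rw [h2] at h1
    apply Complex.ext
    · simpa [rightTriangleVertices, hs.ne'] using h1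
    · simpa [rightTriangleVertices] using h2
  · have h2 := h2 (by decide)
    have h0 := h0 (by decide)
    apply Complex.ext
    · simp [rightTriangleVertices, -Complex.ofReal_cos]; linarith
    · simpa [rightTriangleVertices, -Complex.ofReal_cos] using h2
  · have h0 := h0 (by decide)
    have h1 := h1 (by decide)
    have h0 : z.re = Real.cos θ := by linarith
    rw [h0] at h1
    have h1 : z.im = Real.sin θ := mul_left_cancel₀ hc.ne' (by linarith)
    apply Complex.ext <;>
      simp [vertex_eq, -Complex.ofReal_cos, -Complex.ofReal_sin, h0, h1]

end Acute

/-! ### Boundary correspondence of the sides -/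

/-- A preconnected set covered by three closed sets that are disjoint on it is contained in one. -/
theorem IsPreconnected.subset_one_of_three {X : Type*} [TopologicalSpace X] {s : Set X}
    (hs : IsPreconnected s) {u : Fin 3 → Set X} (hu : ∀ i, IsClosed (u i))
    (hcov : ∀ x ∈ s, ∃ i, x ∈ u i) (hdisj : ∀ x ∈ s, ∀ i j, x ∈ u i → x ∈ u j → i = j) :
    ∃ i, s ⊆ u i := by
  rw [isPreconnected_iff_subset_of_disjoint_closed] at hs
  by_contra! h
  have key : ∀ i j k : Fin 3, (∀ l, l = i ∨ l = j ∨ l = k) → i ≠ j → i ≠ k → s ⊆ u j ∪ u k := by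
    intro i j k hl hij hik
    refine (hs (u i) (u j ∪ u k) (hu i) ((hu j).union (hu k)) ?_ ?_).resolve_left (h i)
    · intro x hx
      obtain ⟨l, hxl⟩ := hcov x hx
      rcases hl l with rfl | rfl | rfl
      · exact Or.inl hxl
      · exact Or.inr (Or.inl hxl)
      · exact Or.inr (Or.inr hxl)
    · rw [eq_empty_iff_forall_notMem]
      rintro x ⟨hx, hxi, hxj | hxk⟩
      · exact hij (hdisj x hx _ _ hxi hxj)
      · exact hik (hdisj x hx _ _ hxi hxk)
  have h12 := key 0 1 2 (by decide) (by decide) (by decide)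
  have h02 := key 1 0 2 (by decide) (by decide) (by decide)
  refine h 2 fun x hx => ?_
  rcases h12 hx with h1 | h1
  · rcases h02 hx with h2 | h2
    · exact absurd (hdisj x hx _ _ h1 h2) (by decide)
    · exact h2
  · exact h1

/-- The boundary extension of a triangle map takes each side into the corresponding side line. -/
theorem sideForm_extension_eq_zero {α β : ℝ} (hα : 0 < α ∧ α < Real.pi / 2)
    (hβ : 0 < β ∧ β < Real.pi / 2) {f e : ℂ → ℂ}
    (hf : BijOn f (openTriangle (rightTriangleVertices α)) (openTriangle (rightTriangleVertices β)))
    (hef : EqOn e f (openTriangle (rightTriangleVertices α)))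
    (hec : ContinuousOn e (closure (openTriangle (rightTriangleVertices α))))
    (heb : BijOn e (closure (openTriangle (rightTriangleVertices α)))
      (closure (openTriangle (rightTriangleVertices β))))
    (hev : ∀ i, e (rightTriangleVertices α i) = rightTriangleVertices β i)
    {i : Fin 3} {z : ℂ} (hz : sideForm α i z = 0) (hz' : ∀ j, j ≠ i → 0 < sideForm α j z) :
    sideForm β i (e z) = 0 := by
  rw [closure_openTriangle_rightTriangleVertices hα] at hec heb
  rw [closure_openTriangle_rightTriangleVertices hβ] at heb
  rw [openTriangle_rightTriangleVertices hα] at hf hef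
  rw [openTriangle_rightTriangleVertices hβ] at hf
  set S : Set ℂ := {x | (∀ j ∈ ({i}ᶜ : Set (Fin 3)), 0 < sideForm α j x) ∧
    ∀ j ∉ ({i}ᶜ : Set (Fin 3)), sideForm α j x = 0} with hS
  have hzS : z ∈ S := ⟨hz', by simpa using hz⟩
  have hSK : S ⊆ {z | ∀ i, 0 ≤ sideForm α i z} := by
    rintro x ⟨hx, hx'⟩ j
    by_cases h : j ∈ ({i}ᶜ : Set (Fin 3))
    · exact (hx j h).le
    · exact (hx' j h).ge
  have hvK : ∀ j, rightTriangleVertices α j ∈ {z | ∀ i, 0 ≤ sideForm α i z} :=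
    fun j k => sideForm_vertex_nonneg hα k j
  have hpre : IsPreconnected (e '' S) := by
    refine IsPreconnected.image (Convex.isPreconnected ?_) e (hec.mono hSK)
    rintro x ⟨hx, hx'⟩ y ⟨hy, hy'⟩ a b ha hb hab
    refine ⟨fun j hj => ?_, fun j hj => ?_⟩
    · rw [sideForm_combo _ _ _ _ hab]
      have h1 := hx j hj
      have h2 := hy j hj
      rcases ha.eq_or_lt with rfl | ha
      · obtain rfl : b = 1 := by linarith
        simpa using h2
      · positivity
    · rw [sideForm_combo _ _ _ _ hab, hx' j hj, hy' j hj]; simp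
  -- The connected image of the open side misses the open triangle, whose points already have
  -- interior preimages, and misses the vertices, which are images of vertices. So it lies on a
  -- single side line.
  obtain ⟨k, hk⟩ := hpre.subset_one_of_three (u := fun j => {y | sideForm β j y = 0})
    (fun j => isClosed_eq (continuous_sideForm β j) continuous_const) (by
      rintro _ ⟨x, hx, rfl⟩
      by_contra! h
      have hxT : ∀ j, 0 < sideForm β j (e x) :=
        fun j => lt_of_le_of_ne (heb.mapsTo (hSK hx) j) (Ne.symm (h j))
      obtain ⟨x', hx', hxe⟩ := hf.surjOn hxT
      rw [← hef hx'] at hxe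
      obtain rfl := heb.injOn (fun j => (hx' j).le) (hSK hx) hxe
      exact absurd (hx.2 i (by simp)) (hx' i).ne') (by
      rintro _ ⟨x, hx, rfl⟩ j k hj hk
      by_contra hjk
      obtain ⟨l, hl⟩ : ∃ l : Fin 3, ∀ m, m ≠ l → m = j ∨ m = k := by
        have : ∀ j k : Fin 3, j ≠ k → ∃ l : Fin 3, ∀ m, m ≠ l → m = j ∨ m = k := by decide
        exact this j k hjk
      have : e x = rightTriangleVertices β l := by
        refine eq_vertex_of_sideForm_eq_zero hβ l fun m hm => ?_
        rcases hl m hm with rfl | rfl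
        · exact hj
        · exact hk
      rw [← hev l] at this
      obtain rfl := heb.injOn (hSK hx) (hvK l) this
      have h1 := sideForm_vertex_self hα l
      by_cases hli : l = i
      · subst hli
        exact h1.ne' (hx.2 l (by simp))
      · obtain ⟨m, hmi, hml⟩ : ∃ m : Fin 3, m ≠ i ∧ m ≠ l :=
          (by decide : ∀ i l : Fin 3, ∃ m : Fin 3, m ≠ i ∧ m ≠ l) i l
        exact (hx.1 m hmi).ne' (sideForm_vertex_ne hml))
  -- Were `k ≠ i`, vertex `k` would be an end of side `i`, and continuity would put its image,
  -- vertex `k` of the target, on the line opposite to it.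
  have hki : k = i := by
    by_contra hki
    have hcl : rightTriangleVertices α k ∈ closure S := by
      refine mem_closure_of_forall_sideForm hzS.1 hzS.2 (hvK k) fun j hj => ?_
      have : j = i := by simpa using hj
      exact sideForm_vertex_ne (this ▸ Ne.symm hki)
    have hcont : ContinuousWithinAt e S (rightTriangleVertices α k) :=
      (hec _ (hvK k)).mono hSK
    have h1 := hcont.mem_closure_image hcl
    have h2 := (isClosed_eq (continuous_sideForm β k) continuous_const).closure_subset_iff.2 hk h1
    rw [hev] at h2
    exact (sideForm_vertex_self hβ k).ne' h2
  rw [← hki]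
  exact hk ⟨z, hzS, rfl⟩

/-! ### Schwarz reflection of function elements -/

namespace FunctionElement

/-- The function element conjugated by the reflections in corresponding sides of two standard
right triangles. -/
noncomputable def reflect (α β : ℝ) (i : Fin 3) (F : FunctionElement) : FunctionElement where
  domain := sideReflection α i ⁻¹' F.domain
  toFun z := sideReflection β i (F.toFun (sideReflection α i z))
  isOpen_domain := F.isOpen_domain.preimage (continuous_sideReflection α i)
  isConnected_domain := by
    rw [← image_eq_preimage_of_inverse (sideReflection_involutive α i)
      (sideReflection_involutive α i)]
    exact F.isConnected_domain.image _ (continuous_sideReflection α i).continuousOn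
  differentiableOn := fun _ hz => (DifferentiableAt.lineReflection_comp
    (F.differentiableOn.differentiableAt (F.isOpen_domain.mem_nhds hz))).differentiableWithinAt

theorem DirectContinuation.symm {F G : FunctionElement} (h : F.DirectContinuation G) :
    G.DirectContinuation F :=
  ⟨by rw [inter_comm]; exact h.1, by rw [inter_comm]; exact h.2.symm⟩

theorem DirectContinuation.reflect {F G : FunctionElement} (h : F.DirectContinuation G) (α β : ℝ)
    (i : Fin 3) : (F.reflect α β i).DirectContinuation (G.reflect α β i) := by
  obtain ⟨⟨x, hx⟩, heq⟩ := h
  refine ⟨⟨sideReflection α i x, ?_⟩, fun z hz => ?_⟩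
  · change sideReflection α i (sideReflection α i x) ∈ F.domain ∩ G.domain
    rwa [sideReflection_involutive α i x]
  · exact congrArg (sideReflection β i) (heq hz)

/-- A chain from `F` to `G` reflects to a chain from the reflected `F` to the reflected `G`. Hence
continuation across the sides of the initial triangle alone yields invariance of the whole family.
-/
theorem reflect_mem_globalAnalyticFunction {F G : FunctionElement} {α β : ℝ} {i : Fin 3}
    (hF : F.reflect α β i ∈ F.globalAnalyticFunction) (hG : G ∈ F.globalAnalyticFunction) :
    G.reflect α β i ∈ F.globalAnalyticFunction :=
  hF.trans (Relation.ReflTransGen.lift (p := DirectContinuation) (reflect α β i)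
    (fun _ _ (h : DirectContinuation _ _) => h.reflect α β i) F G hG)

theorem reflect_mem_graphs {F : FunctionElement} {α β : ℝ} {i : Fin 3}
    (hF : F.reflect α β i ∈ F.globalAnalyticFunction) {x y : ℂ}
    (h : (x, y) ∈ ⋃ G ∈ F.globalAnalyticFunction, G.graph) :
    (sideReflection α i x, sideReflection β i y) ∈ ⋃ G ∈ F.globalAnalyticFunction, G.graph := by
  simp only [mem_iUnion] at h ⊢
  obtain ⟨G, hG, hx, hy⟩ := h
  refine ⟨G.reflect α β i, reflect_mem_globalAnalyticFunction hF hG, ?_, ?_⟩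
  · change sideReflection α i (sideReflection α i x) ∈ G.domain
    rwa [sideReflection_involutive α i x]
  · change sideReflection β i y =
      sideReflection β i (G.toFun (sideReflection α i (sideReflection α i x)))
    rw [sideReflection_involutive α i x]
    exact congrArg _ hy

end FunctionElement

/-- **Schwarz reflection**: the map of right triangles continues analytically across each side to
its reflection. -/
theorem IsTriangleMap.reflect_mem_globalAnalyticFunction {α β : ℝ}
    (hα : 0 < α ∧ α < Real.pi / 2) (hβ : 0 < β ∧ β < Real.pi / 2) {F : FunctionElement}
    (hF : IsTriangleMap (rightTriangleVertices α) (rightTriangleVertices β) F) (i : Fin 3) :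
    F.reflect α β i ∈ F.globalAnalyticFunction := by
  obtain ⟨e, hef, hec, heb, hev⟩ := hF.exists_extension
  have hside := fun z h h' => sideForm_extension_eq_zero hα hβ hF.bijOn hef hec heb hev
    (i := i) (z := z) h h'
  have hdom := hF.domain_eq
  rw [closure_openTriangle_rightTriangleVertices hα] at hec
  rw [openTriangle_rightTriangleVertices hα] at hef hdom
  obtain ⟨p, hp, hp'⟩ := exists_mem_side hα i
  have hρp := sideReflection_eq_self hp
  set ρ := sideReflection α i with hρ
  set σ := sideReflection β i with hσ
  have hρc : Continuous ρ := continuous_sideReflection α i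
  have hσc : Continuous σ := continuous_sideReflection β i
  have hℓc := continuous_sideForm α
  -- Near an interior point `p` of the side, both `z` and its mirror image stay clear of the other
  -- two side lines, so the sign of `sideForm α i z` alone decides which of them is in the triangle.
  have hN : ∀ᶠ z in 𝓝 p, ∀ j, j ≠ i → 0 < sideForm α j z ∧ 0 < sideForm α j (ρ z) := by
    rw [eventually_all]
    intro j
    by_cases hj : j = i
    · exact Eventually.of_forall fun z h => absurd hj h
    · have h1 := (hℓc j).continuousAt.eventually_const_lt (hp' j hj)
      have h2 := ((hℓc j).comp hρc).continuousAt (x := p) |>.eventually_const_lt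
        (show 0 < sideForm α j (ρ p) by rw [hρp]; exact hp' j hj)
      filter_upwards [h1, h2] with z h1 h2 _ using ⟨h1, h2⟩
  obtain ⟨r, hr, hball⟩ := Metric.eventually_nhds_iff_ball.1 hN
  have hℓρ : ∀ z, sideForm α i (ρ z) = -sideForm α i z := sideForm_sideReflection α i
  -- The two pieces match on the side, where `ρ` fixes `z` and `σ` fixes `e z`. The resulting
  -- element on the disc links `F` to its reflection.
  let g : ℂ → ℂ := fun z => if 0 ≤ sideForm α i z then e z else σ (e (ρ z))
  have hpos : ∀ z ∈ Metric.ball p r, 0 < sideForm α i z → z ∈ F.domain := by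
    intro z hz h
    rw [hdom]
    intro j
    rcases eq_or_ne j i with rfl | hj
    · exact h
    · exact (hball z hz j hj).1
  have hneg : ∀ z ∈ Metric.ball p r, sideForm α i z < 0 → ρ z ∈ F.domain := by
    intro z hz h
    rw [hdom]
    intro j
    rcases eq_or_ne j i with rfl | hj
    · rw [hℓρ]; linarith
    · exact (hball z hz j hj).2
  have hgF : ∀ z ∈ Metric.ball p r, 0 < sideForm α i z → g z = F.toFun z := by
    intro z hz h
    have := hpos z hz h
    rw [hdom] at this
    simp only [g, if_pos h.le]
    exact hef this
  have hgR : ∀ z ∈ Metric.ball p r, sideForm α i z < 0 → g z = σ (F.toFun (ρ z)) := by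
    intro z hz h
    have := hneg z hz h
    rw [hdom] at this
    simp only [g, if_neg h.not_ge]
    rw [hef this]
  have hgc : ContinuousOn g (Metric.ball p r) := by
    apply ContinuousOn.if
    · rintro z ⟨hz, hz'⟩
      have h0 : 0 = sideForm α i z := frontier_le_subset_eq continuous_const (hℓc i) hz'
      rw [hρ, sideReflection_eq_self h0.symm, hσ, sideReflection_eq_self]
      exact hside z h0.symm fun j hj => (hball z hz j hj).1
    · refine hec.mono ?_
      rintro z ⟨hz, hz'⟩ j
      rw [(isClosed_le continuous_const (hℓc i)).closure_eq] at hz'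
      rcases eq_or_ne j i with rfl | hj
      · exact hz'
      · exact (hball z hz j hj).1.le
    · refine hσc.comp_continuousOn (hec.comp hρc.continuousOn ?_)
      rintro z ⟨hz, hz'⟩ j
      have h0 : sideForm α i z ≤ 0 := by
        refine closure_minimal ?_ (isClosed_le (hℓc i) continuous_const) hz'
        intro y hy
        exact (not_le.1 hy).le
      rcases eq_or_ne j i with rfl | hj
      · rw [hℓρ]; linarith
      · exact (hball z hz j hj).2.le
  have hgd : DifferentiableOn ℂ g (Metric.ball p r) := by
    refine differentiableOn_ball_of_off_line (q := sideBase α i) (norm_sideDir α i) hgc ?_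
    rintro z ⟨hz, hz0⟩
    refine DifferentiableAt.differentiableWithinAt ?_
    have hnhds := Metric.isOpen_ball.mem_nhds hz
    rcases lt_or_gt_of_ne hz0 with h | h
    · refine (DifferentiableAt.lineReflection_comp (q' := sideBase β i) (w' := sideDir β i)
        (F.differentiableOn.differentiableAt
        (F.isOpen_domain.mem_nhds (hneg z hz h)))).congr_of_eventuallyEq ?_
      filter_upwards [hnhds, (hℓc i).continuousAt.eventually_lt_const h] with y hy hy'
      exact hgR y hy hy'
    · refine (F.differentiableOn.differentiableAt
        (F.isOpen_domain.mem_nhds (hpos z hz h))).congr_of_eventuallyEq ?_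
      filter_upwards [hnhds, (hℓc i).continuousAt.eventually_const_lt h] with y hy hy'
      exact hgF y hy hy'
  let H : FunctionElement := ⟨Metric.ball p r, g, Metric.isOpen_ball,
    ⟨⟨p, Metric.mem_ball_self hr⟩, (convex_ball p r).isPreconnected⟩, hgd⟩
  have hcl : p ∈ closure F.domain := by
    rw [hdom, ← openTriangle_rightTriangleVertices hα,
      closure_openTriangle_rightTriangleVertices hα]
    intro j
    rcases eq_or_ne j i with rfl | hj
    · exact hp.ge
    · exact (hp' j hj).le
  have hFpos : ∀ z ∈ F.domain, 0 < sideForm α i z := by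
    intro z hz
    rw [hdom] at hz
    exact hz i
  have hFH : F.DirectContinuation H := by
    refine ⟨?_, fun z hz => (hgF z hz.2 (hFpos z hz.1)).symm⟩
    rw [inter_comm]
    exact mem_closure_iff.1 hcl _ Metric.isOpen_ball (Metric.mem_ball_self hr)
  have hHR : H.DirectContinuation (F.reflect α β i) := by
    refine ⟨?_, fun z hz => ?_⟩
    · obtain ⟨z, hz, hzF⟩ := mem_closure_iff.1 hcl _ (Metric.isOpen_ball.preimage hρc)
        (show ρ p ∈ Metric.ball p r by rw [hρp]; exact Metric.mem_ball_self hr)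
      refine ⟨ρ z, hz, ?_⟩
      change ρ (ρ z) ∈ F.domain
      rwa [hρ, sideReflection_involutive α i z]
    · refine hgR z hz.1 ?_
      have := hFpos _ hz.2
      rw [sideForm_sideReflection] at this
      linarith
  exact (Relation.ReflTransGen.single hFH).tail hHR

/-! ### Translations generated by the reflections, and recurrence -/

theorem sideReflection_zero (θ : ℝ) (z : ℂ) :
    sideReflection θ 0 z = 2 * Real.cos θ - conj z := by
  simp only [sideReflection, lineReflection, sideBase, sideDir, Matrix.cons_val_zero, map_mul,
    map_sub, map_neg, Complex.conj_I, Complex.conj_ofReal]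
  linear_combination (conj z - Real.cos θ) * Complex.I_mul_I

theorem sideReflection_one (θ : ℝ) (z : ℂ) :
    sideReflection θ 1 z = Complex.exp (2 * θ * Complex.I) * conj z := by
  have h : conj (Complex.exp (-(θ : ℂ) * Complex.I)) = Complex.exp (θ * Complex.I) := by
    rw [← Complex.exp_conj]; simp
  have h2 : Complex.exp (2 * θ * Complex.I) =
      Complex.exp (θ * Complex.I) * Complex.exp (θ * Complex.I) := by
    rw [← Complex.exp_add]; congr 1; ring
  simp only [sideReflection, lineReflection, sideBase, sideDir, Matrix.cons_val_zero,
    Matrix.cons_val_one, map_mul, map_sub, map_neg, h, map_zero, h2]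
  ring

theorem sideReflection_two (θ : ℝ) (z : ℂ) : sideReflection θ 2 z = conj z := by
  simp [sideReflection, lineReflection, sideBase, sideDir]

/-- A set invariant under pairs of corresponding side reflections is invariant under the
translations generated by them. -/
theorem translate_mem_of_reflect_mem {α β : ℝ} {S : Set (ℂ × ℂ)}
    (hS : ∀ (i : Fin 3) (x y : ℂ), (x, y) ∈ S → (sideReflection α i x, sideReflection β i y) ∈ S)
    (k : ℕ) {x y : ℂ} (h : (x, y) ∈ S) :
    (x + 2 * Real.cos α * (Complex.exp (2 * α * Complex.I) ^ k - 1),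
      y + 2 * Real.cos β * (Complex.exp (2 * β * Complex.I) ^ k - 1)) ∈ S := by
  have hnorm : ∀ θ : ℝ, Complex.exp (2 * θ * Complex.I) *
      conj (Complex.exp (2 * θ * Complex.I)) = 1 :=
    fun θ => mul_conj_of_norm_eq_one (by
      have := Complex.norm_exp_ofReal_mul_I (2 * θ)
      push_cast at this
      exact this)
  have hα := hnorm α
  have hβ := hnorm β
  set u := Complex.exp (2 * α * Complex.I)
  set v := Complex.exp (2 * β * Complex.I)
  -- The sides at the right angle are perpendicular, so their reflections compose to a half turn.
  have hR : ∀ x y : ℂ, (x, y) ∈ S → (2 * Real.cos α - x, 2 * Real.cos β - y) ∈ S := by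
    intro x y h
    simpa [sideReflection_two, sideReflection_zero] using hS 0 _ _ (hS 2 _ _ h)
  have hT : ∀ (k : ℕ) (x y : ℂ), (x, y) ∈ S → (u ^ k * x, v ^ k * y) ∈ S := by
    intro k x y h
    induction k with
    | zero => simpa using h
    | succ k ih =>
      convert hS 1 _ _ (hS 2 _ _ ih) using 2 <;>
        rw [sideReflection_one, sideReflection_two, Complex.conj_conj, pow_succ', mul_assoc]
  have hT' : ∀ (k : ℕ) (x y : ℂ), (x, y) ∈ S → (conj u ^ k * x, conj v ^ k * y) ∈ S := by
    intro k x y h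
    induction k with
    | zero => simpa using h
    | succ k ih =>
      convert hS 2 _ _ (hS 1 _ _ ih) using 2 <;>
        rw [sideReflection_one, sideReflection_two, map_mul, Complex.conj_conj, pow_succ',
          mul_assoc]
  have huk : u ^ k * conj u ^ k = 1 := by rw [← mul_pow, hα, one_pow]
  have hvk : v ^ k * conj v ^ k = 1 := by rw [← mul_pow, hβ, one_pow]
  -- A half turn about `cos α`, then one about `u ^ k * cos α`: their product translates by twice
  -- the difference of the centres.
  have := hT k _ _ (hR _ _ (hT' k _ _ (hR _ _ h)))
  convert this using 2
  · linear_combination (2 * Real.cos α - x) * huk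
  · linear_combination (2 * Real.cos β - y) * hvk

/-- Simultaneous recurrence of two rotations that do not have a common period. -/
theorem exists_pow_tendsto_one {u v : ℂ} (hu : ‖u‖ = 1) (hv : ‖v‖ = 1)
    (h : ∀ k : ℕ, 0 < k → ¬(u ^ k = 1 ∧ v ^ k = 1)) :
    ∃ k : ℕ → ℕ, (∀ n, ¬(u ^ k n = 1 ∧ v ^ k n = 1)) ∧
      Tendsto (fun n => u ^ k n) atTop (𝓝 1) ∧ Tendsto (fun n => v ^ k n) atTop (𝓝 1) := by
  obtain ⟨p, -, φ, hφ, hlim⟩ := tendsto_subseq_of_bounded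
    (Metric.isBounded_closedBall (x := (0 : ℂ × ℂ)) (r := 1)) (x := fun n : ℕ => (u ^ n, v ^ n))
    (fun n => by simp [Prod.norm_def, hu, hv])
  -- Quotients of consecutive terms of a convergent subsequence on the torus tend to `1`; strict
  -- growth of `φ` makes the exponents positive.
  have hlt : ∀ n, φ n < φ (n + 1) := fun n => hφ (Nat.lt_succ_self n)
  have key : ∀ (w q : ℂ), ‖w‖ = 1 → Tendsto (fun n => w ^ φ n) atTop (𝓝 q) →
      Tendsto (fun n => w ^ (φ (n + 1) - φ n)) atTop (𝓝 1) := by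
    intro w q hw hq
    have hw0 : w ≠ 0 := fun h0 => by simp [h0] at hw
    have hq1 : ‖q‖ = 1 := by
      refine tendsto_nhds_unique hq.norm ?_
      simp [hw]
    have hq0 : q ≠ 0 := fun h0 => by simp [h0] at hq1
    have := ((tendsto_add_atTop_iff_nat 1).2 hq).div hq hq0
    rw [div_self hq0] at this
    refine this.congr fun n => ?_
    rw [Pi.div_apply, div_eq_iff (pow_ne_zero _ hw0), ← pow_add, Nat.sub_add_cancel (hlt n).le]
  exact ⟨fun n => φ (n + 1) - φ n, fun n => h _ (Nat.sub_pos_of_lt (hlt n)),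
    key u p.1 hu ((continuous_fst.tendsto p).comp hlim),
    key v p.2 hv ((continuous_snd.tendsto p).comp hlim)⟩

/-! ### Rigidity under small translations -/

/-- A holomorphic function on a convex domain that is eventually invariant, at each point, under a
sequence of arbitrarily small translations of its graph is affine. -/
theorem exists_affine_of_eventually_translate_eq {f : ℂ → ℂ} {U : Set ℂ} (hU : IsOpen U)
    (hUc : Convex ℝ U) (hne : U.Nonempty) (hf : DifferentiableOn ℂ f U) {a b : ℕ → ℂ}
    (ha : Tendsto a atTop (𝓝 0)) (hab : ∀ n, ¬(a n = 0 ∧ b n = 0))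
    (h : ∀ x ∈ U, ∀ᶠ n in atTop, f (x - a n) + b n = f x) :
    ∃ c d : ℂ, ∀ x ∈ U, f x = c * x + d := by
  let V : ℕ → Set ℂ := fun n => U ∩ (fun x => x - a n) ⁻¹' U
  have hVo : ∀ n, IsOpen (V n) := fun n => hU.inter (hU.preimage (by fun_prop))
  have hVc : ∀ n, Convex ℝ (V n) := fun n => by
    refine hUc.inter ?_
    simpa [sub_eq_add_neg] using hUc.translate_preimage_left (-a n)
  have hdiff : ∀ n, DifferentiableOn ℂ (fun x => f (x - a n) + b n) (V n) := fun n =>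
    (hf.comp (by fun_prop) fun x hx => hx.2).add_const _
  have hmem : ∀ x ∈ U, ∀ᶠ n in atTop, x ∈ V n := by
    intro x hx
    have : Tendsto (fun n => x - a n) atTop (𝓝 x) := by simpa using tendsto_const_nhds.sub ha
    filter_upwards [this.eventually (hU.mem_nhds hx)] with n hn using ⟨hx, hn⟩
  -- Otherwise, beyond some `N`, every coincidence set is countable, yet their union would cover the
  -- nonempty open set `U`.
  have hfreq : ∃ᶠ n in atTop, EqOn (fun x => f (x - a n) + b n) f (V n) := by
    intro hcon
    obtain ⟨N, hN⟩ := eventually_atTop.1 hcon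
    have hcount : (⋃ n : {n // N ≤ n}, {x | x ∈ V n ∧ f (x - a n) + b n = f x}).Countable :=
      countable_iUnion fun n => (eqOn_or_countable_setOf_eq (hVo n) (hVc n).isPreconnected
        (hdiff n) (hf.mono inter_subset_left)).resolve_left (hN n n.2)
    obtain ⟨x, hx, hx'⟩ := (hcount.dense_compl ℝ).inter_open_nonempty U hU hne
    obtain ⟨n, hn1, hn2, hn3⟩ := ((hmem x hx).and ((h x hx).and (eventually_ge_atTop N))).exists
    exact hx' (mem_iUnion.2 ⟨⟨n, hn3⟩, hn1, hn2⟩)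
  obtain ⟨x₀, hx₀⟩ := hne
  have htend : Tendsto (fun n => x₀ - a n) atTop (𝓝 x₀) := by
    simpa using tendsto_const_nhds.sub ha
  -- Differentiating the identity removes `b n`. The points `x₀ - a n` differ from `x₀`, since `a n
  -- = 0` in the identity would force `b n = 0`.
  have hderiv : ∃ᶠ y in 𝓝[≠] x₀, deriv f y = deriv f x₀ := by
    rw [frequently_nhdsWithin_iff]
    refine htend.frequently ((hfreq.and_eventually (hmem x₀ hx₀)).mono ?_)
    rintro n ⟨heq, hx⟩
    refine ⟨?_, fun hx' => ?_⟩
    · have h1 : (fun x => f (x - a n) + b n) =ᶠ[𝓝 x₀] f :=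
        heq.eventuallyEq_of_mem ((hVo n).mem_nhds hx)
      have h2 := h1.deriv_eq
      rwa [deriv_add_const, deriv_comp_sub_const] at h2
    · have ha0 : a n = 0 := by simpa using hx'
      refine hab n ⟨ha0, ?_⟩
      have := heq hx
      simpa [ha0] using this
  have hconst : EqOn (deriv f) (fun _ => deriv f x₀) U :=
    ((hf.analyticOnNhd hU).deriv).eqOn_of_preconnected_of_frequently_eq analyticOnNhd_const
      hUc.isPreconnected hx₀ hderiv
  refine ⟨deriv f x₀, f x₀ - deriv f x₀ * x₀, ?_⟩
  refine hU.eqOn_of_deriv_eq hUc.isPreconnected hf (by fun_prop) (fun x hx => ?_) hx₀ (by ring)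
  rw [hconst hx, deriv_add_const, deriv_const_mul_field, deriv_id'']
  simp

/-! ### Angles, and the conclusion -/

theorem exists_rat_mul_pi_of_exp_pow_eq_one {θ : ℝ} {k : ℕ} (hk : 0 < k)
    (h : Complex.exp (2 * θ * Complex.I) ^ k = 1) : ∃ q : ℚ, θ = q * Real.pi := by
  rw [← Complex.exp_nat_mul, Complex.exp_eq_one_iff] at h
  obtain ⟨n, hn⟩ := h
  have h1 : (k : ℂ) * θ = n * Real.pi := by
    apply mul_right_cancel₀ (mul_ne_zero two_ne_zero Complex.I_ne_zero)
    linear_combination hn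
  have h2 : (k : ℝ) * θ = n * Real.pi := by exact_mod_cast h1
  refine ⟨n / k, ?_⟩
  have hk' : (k : ℝ) ≠ 0 := by exact_mod_cast hk.ne'
  push_cast
  field_simp
  linarith

/-- A triangle map between standard right triangles that is affine has equal angles. -/
theorem IsTriangleMap.angle_eq_of_affine {α β : ℝ} (hα : 0 < α ∧ α < Real.pi / 2)
    (hβ : 0 < β ∧ β < Real.pi / 2) {F : FunctionElement}
    (hF : IsTriangleMap (rightTriangleVertices α) (rightTriangleVertices β) F) {c d : ℂ}
    (h : ∀ x ∈ openTriangle (rightTriangleVertices α), F.toFun x = c * x + d) : α = β := by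
  obtain ⟨e, hef, hec, -, hev⟩ := hF.exists_extension
  have he : EqOn e (fun x => c * x + d) (closure (openTriangle (rightTriangleVertices α))) :=
    EqOn.of_subset_closure (fun x hx => (hef hx).trans (h x hx)) hec (by fun_prop)
      subset_closure Subset.rfl
  have hv : ∀ i, rightTriangleVertices β i = c * rightTriangleVertices α i + d := fun i => by
    rw [← hev i]
    refine he ?_
    rw [closure_openTriangle_rightTriangleVertices hα]
    exact fun j => sideForm_vertex_nonneg hα j i
  have h0 : d = 0 := by simpa [rightTriangleVertices] using (hv 0).symm
  have h1 : (Real.cos β : ℂ) = c * Real.cos α := by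
    simpa [rightTriangleVertices, h0, -Complex.ofReal_cos] using hv 1
  have h2 : Complex.exp (β * Complex.I) = c * Complex.exp (α * Complex.I) := by
    simpa [rightTriangleVertices, h0] using hv 2
  -- Both hypotenuses have length `1`, so the similarity ratio is `1` and the adjacent legs have
  -- equal length.
  have hc : ‖c‖ = 1 := by
    have := congrArg norm h2
    rwa [norm_mul, Complex.norm_exp_ofReal_mul_I, Complex.norm_exp_ofReal_mul_I, mul_one,
      eq_comm] at this
  have hcos : Real.cos β = Real.cos α := by
    have := congrArg norm h1
    rwa [norm_mul, hc, one_mul, Complex.norm_real, Complex.norm_real, Real.norm_of_nonneg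
      (cos_pos_of_acute hα).le, Real.norm_of_nonneg (cos_pos_of_acute hβ).le] at this
  have hπ := Real.pi_pos
  exact (Real.injOn_cos ⟨hβ.1.le, by linarith [hβ.2]⟩ ⟨hα.1.le, by linarith [hα.2]⟩ hcos).symm

theorem mainTheorem11 (α β : ℝ) (hα : 0 < α ∧ α < Real.pi / 2) (hβ : 0 < β ∧ β < Real.pi / 2)
    (hαβ : α ≠ β) (F : FunctionElement)
    (hF : IsTriangleMap (rightTriangleVertices α) (rightTriangleVertices β) F)
    (hdisc : IsDiscreteSurface F.riemannSurface) :
    (∃ q : ℚ, α = q * Real.pi) ∧ (∃ q : ℚ, β = q * Real.pi) := by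
  by_contra hirr
  have hnorm : ∀ θ : ℝ, ‖Complex.exp (2 * θ * Complex.I)‖ = 1 := fun θ => by
    have := Complex.norm_exp_ofReal_mul_I (2 * θ)
    push_cast at this
    exact this
  -- A common period would make both angles rational multiples of `π`, so recurrence applies even if
  -- only one of them fails to be.
  obtain ⟨k, hk, hku, hkv⟩ := exists_pow_tendsto_one (hnorm α) (hnorm β) fun k hk0 hk =>
    hirr ⟨exists_rat_mul_pi_of_exp_pow_eq_one hk0 hk.1,
      exists_rat_mul_pi_of_exp_pow_eq_one hk0 hk.2⟩
  set u := Complex.exp (2 * α * Complex.I) with hu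
  set v := Complex.exp (2 * β * Complex.I) with hv
  let a : ℕ → ℂ := fun n => 2 * Real.cos α * (u ^ k n - 1)
  let b : ℕ → ℂ := fun n => 2 * Real.cos β * (v ^ k n - 1)
  have ha : Tendsto a atTop (𝓝 0) := by
    simpa only [sub_self, mul_zero] using (hku.sub_const 1).const_mul (2 * (Real.cos α : ℂ))
  have hb : Tendsto b atTop (𝓝 0) := by
    simpa only [sub_self, mul_zero] using (hkv.sub_const 1).const_mul (2 * (Real.cos β : ℂ))
  have hab : ∀ n, ¬(a n = 0 ∧ b n = 0) := by
    rintro n ⟨h1, h2⟩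
    have hcα : (2 * Real.cos α : ℂ) ≠ 0 :=
      mul_ne_zero two_ne_zero (Complex.ofReal_ne_zero.2 (cos_pos_of_acute hα).ne')
    have hcβ : (2 * Real.cos β : ℂ) ≠ 0 :=
      mul_ne_zero two_ne_zero (Complex.ofReal_ne_zero.2 (cos_pos_of_acute hβ).ne')
    exact hk n ⟨sub_eq_zero.1 ((mul_eq_zero.1 h1).resolve_left hcα),
      sub_eq_zero.1 ((mul_eq_zero.1 h2).resolve_left hcβ)⟩
  have hopen : IsOpen F.domain := F.isOpen_domain
  have hconv : Convex ℝ F.domain := by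
    rw [hF.domain_eq]; exact (convex_convexHull ℝ _).interior
  have hgraph : ∀ x ∈ F.domain, (x, F.toFun x) ∈ ⋃ G ∈ F.globalAnalyticFunction, G.graph :=
    fun x hx => mem_biUnion (show F ∈ F.globalAnalyticFunction from Relation.ReflTransGen.refl)
      ⟨hx, rfl⟩
  have hev : ∀ x ∈ F.domain, ∀ᶠ n in atTop, F.toFun (x - a n) + b n = F.toFun x := by
    intro x hx
    obtain ⟨ε, hε, hball⟩ :=
      Metric.exists_ball_inter_eq_singleton_of_mem_discrete (hdisc x)
        (show F.toFun x ∈ surfaceSection F.riemannSurface x from Or.inl (hgraph x hx))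
    have hsub : Tendsto (fun n => x - a n) atTop (𝓝 x) := by
      simpa using tendsto_const_nhds.sub ha
    have hlim : Tendsto (fun n => F.toFun (x - a n) + b n) atTop (𝓝 (F.toFun x)) := by
      have hc := (F.differentiableOn.continuousOn.continuousAt (hopen.mem_nhds hx)).tendsto
      simpa using (hc.comp hsub).add hb
    filter_upwards [hsub.eventually (hopen.mem_nhds hx),
      hlim.eventually (Metric.ball_mem_nhds _ hε)] with n hn hn'
    -- Translating the graph point over `x - a n` lands exactly over `x`, within the ball isolating
    -- `F.toFun x` in its section.
    have hS := translate_mem_of_reflect_mem (fun i _ _ => FunctionElement.reflect_mem_graphs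
      (hF.reflect_mem_globalAnalyticFunction hα hβ i)) (k n) (hgraph _ hn)
    rw [← hu, ← hv, show x - a n + 2 * Real.cos α * (u ^ k n - 1) = x from
      sub_add_cancel x (a n)] at hS
    have : F.toFun (x - a n) + b n ∈
        Metric.ball (F.toFun x) ε ∩ surfaceSection F.riemannSurface x := ⟨hn', Or.inl hS⟩
    rw [hball] at this
    exact this
  obtain ⟨c, d, hcd⟩ := exists_affine_of_eventually_translate_eq hopen hconv
    F.isConnected_domain.nonempty F.differentiableOn ha hab hev
  rw [hF.domain_eq] at hcd
  exact hαβ (hF.angle_eq_of_affine hα hβ hcd)
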